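/- Let $\Gamma$ be a nonzero torsion-free commutative cancellative monoid (written additively), let $R=\bigoplus_{\alpha\in\Gamma}R_\alpha$ be an integral domain graded by $\Gamma$, with quotient field $K$, and let $H$ be the set of nonzero homogeneous elements of $R$. Let $\mathbf F(R)$ be the set of nonzero fractional ideals of $R$, and write $(R:A)=A^{-1}=\{x\in K: xA\subseteq R\}$. A fractional ideal $A$ is called homogeneous if $sA$ is a homogeneous ideal of $R$ for some $s\in H$; let $\mathbf{HF}(R)\subseteq\mathbf F(R)$ be the set of nonzero homogeneous fractional ideals. For an ideal $I\subseteq R$ let $\mathbf C(I)$ be the ideal of $R$ generated by the homogeneous components of the elements of $I$. A (classical) star operation on $R$ is a map $\star:\mathbf F(R)\to\mathbf F(R)$, $A\mapsto A^\star$, such that for all $0\ne x\in K$ and $A,B\in\mathbf F(R)$: $(xR)^\star=xR$ and $(xA)^\star=xA^\star$; $A\subseteq A^\star$, and $A\subseteq B$ implies $A^\star\subseteq B^\star$; $(A^\star)^\star=A^\star$. A homogeneous star operation on $R$ is a map $\star:\mathbf{HF}(R)\to\mathbf{HF}(R)$ with the same properties for all $A,B\in\mathbf{HF}(R)$ and all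 nonzero homogeneous elements $x$ of $R_H$ (that is, $x=a/s$ with $a,s\in H$). A star operation on $R$ is homogeneous preserving if it maps $\mathbf{HF}(R)$ into $\mathbf{HF}(R)$; its restriction to $\mathbf{HF}(R)$ is then a homogeneous star operation, denoted by the same symbol. For a homogeneous star operation $\star$ let $\mathfrak e(\star)$ be the star operation on $R$ given by $$A^{\mathfrak e(\star)}=\bigcap\{z^{-1}(\mathbf C(zA))^\star : 0\neq z\in(R:A)\}\qquad(A\in\mathbf F(R)).$$ For a star operation $\star$ on $R$ let $\star_f$ and $\widetilde\star$ be the star operations $$A^{\star_f}=\bigcup\{B^\star : B\in\mathbf F(R)\text{ finitely generated},\ B\subseteq A\},$$ $$A^{\widetilde\star}=\{x\in K : xJ\subseteq A\text{ for some nonzero finitely generated ideal }J\subseteq R\text{ with }J^\star=R\}.$$ Let $v$ be the star operation $A^v=(A^{-1})^{-1}$, and put $t=v_f$ and $w=\widetilde v$. Then $v$, $t$ and $w$ are homogeneous preserving, and: 1. $\mathfrak e(v)=v$; 2. $(\mathfrak e(v))_f=(\mathfrak e(t))_f=t$; 3. $\widetilde{\mathfrak e(v)}=\widetilde{\mathfrak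 e(w)}=w$. -/

import Mathlib

set_option linter.unusedSectionVars false

namespace GradedDomain

open scoped nonZeroDivisors Pointwise

section Star

variable (R : Type*) [CommRing R] [IsDomain R] (K : Type*) [Field K] [Algebra R K]
  [IsFractionRing R K]

/-- `F(R)`: the nonzero fractional ideals of the domain `R` in its quotient field `K`. -/
abbrev NonzeroFractionalIdeal := {A : FractionalIdeal R⁰ K // A ≠ 0}

variable {R K}

namespace NonzeroFractionalIdeal

lemma mul_ne_zero' {A B : FractionalIdeal R⁰ K} (hA : A ≠ 0) (hB : B ≠ 0) : A * B ≠ 0 := by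
  intro h
  refine hA (FractionalIdeal.eq_zero_iff.2 fun a ha => ?_)
  by_contra h0
  refine hB (FractionalIdeal.eq_zero_iff.2 fun b hb => ?_)
  have h1 := FractionalIdeal.mul_mem_mul ha hb
  rw [h] at h1
  exact (mul_eq_zero.1 ((FractionalIdeal.mem_zero_iff R⁰).1 h1)).resolve_left h0

/-- The principal fractional ideal `(x)`, for `x ≠ 0`. -/
noncomputable def principal (x : K) (hx : x ≠ 0) : NonzeroFractionalIdeal R K :=
  ⟨FractionalIdeal.spanSingleton R⁰ x, FractionalIdeal.spanSingleton_ne_zero_iff.2 hx⟩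

/-- The fractional ideal `xA`, for `x ≠ 0`. -/
noncomputable def smul (x : K) (hx : x ≠ 0) (A : NonzeroFractionalIdeal R K) :
    NonzeroFractionalIdeal R K :=
  ⟨FractionalIdeal.spanSingleton R⁰ x * A.1,
    mul_ne_zero' (FractionalIdeal.spanSingleton_ne_zero_iff.2 hx) A.2⟩

/-- The fractional ideal `R`. -/
noncomputable def ring : NonzeroFractionalIdeal R K := ⟨1, one_ne_zero⟩

variable {x y : K} {hx : x ≠ 0} {A B : NonzeroFractionalIdeal R K}

lemma mem_smul : y ∈ (smul x hx A).1 ↔ ∃ a ∈ A.1, y = x * a :=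
  FractionalIdeal.mem_singleton_mul

lemma mul_mem_smul (ha : y ∈ A.1) : x * y ∈ (smul x hx A).1 := mem_smul.2 ⟨y, ha, rfl⟩

lemma smul_le : smul x hx A ≤ B ↔ ∀ a ∈ A.1, x * a ∈ B.1 := by
  constructor
  · intro h a ha
    exact h (mul_mem_smul ha)
  · intro h y hy
    obtain ⟨a, ha, rfl⟩ := mem_smul.1 hy
    exact h a ha

lemma smul_mono (h : A ≤ B) : smul x hx A ≤ smul x hx B :=
  smul_le.2 fun _ ha => mul_mem_smul (h ha)

lemma principal_le (h : x ∈ A.1) : principal x hx ≤ A :=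
  (FractionalIdeal.spanSingleton_le_iff_mem (S := R⁰)).2 h

lemma one_mem_ring : (1 : K) ∈ (ring : NonzeroFractionalIdeal R K).1 := FractionalIdeal.one_mem_one _

lemma ring_le (h : (1 : K) ∈ A.1) : ring ≤ A := FractionalIdeal.one_le.2 h

lemma smul_ring : smul x hx (ring : NonzeroFractionalIdeal R K) = principal x hx :=
  Subtype.ext (mul_one _)

lemma exists_ne_zero (A : NonzeroFractionalIdeal R K) : ∃ a ∈ A.1, a ≠ 0 := by
  by_contra! h
  exact A.2 (FractionalIdeal.eq_zero_iff.2 h)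

lemma smul_smul_inv (x : K) (hx : x ≠ 0) (A : NonzeroFractionalIdeal R K) :
    smul x hx (smul x⁻¹ (inv_ne_zero hx) A) = A := by
  apply Subtype.ext
  simp only [smul, ← mul_assoc, FractionalIdeal.spanSingleton_mul_spanSingleton,
    mul_inv_cancel₀ hx, FractionalIdeal.spanSingleton_one, one_mul]

/-- A principal fractional ideal is finitely generated. -/
lemma principal_fg (x : K) (hx : x ≠ 0) :
    ((principal x hx : NonzeroFractionalIdeal R K).1 : Submodule R K).FG := by
  simp only [principal, FractionalIdeal.coe_spanSingleton]
  exact Submodule.fg_span_singleton x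

/-- The sum of two nonzero fractional ideals. -/
noncomputable def sum (A B : NonzeroFractionalIdeal R K) : NonzeroFractionalIdeal R K :=
  ⟨A.1 ⊔ B.1, fun h => A.2 (le_bot_iff.1 (le_sup_left.trans h.le))⟩

/-- The product of two nonzero fractional ideals. -/
noncomputable def prod (A B : NonzeroFractionalIdeal R K) : NonzeroFractionalIdeal R K :=
  ⟨A.1 * B.1, mul_ne_zero' A.2 B.2⟩

/-- `(R : A) = {x ∈ K | xA ⊆ R}`. -/
noncomputable def inv (A : NonzeroFractionalIdeal R K) : NonzeroFractionalIdeal R K :=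
  ⟨A.1⁻¹, fun h => FractionalIdeal.bot_lt_mul_inv (I := A.1) A.2 |>.ne (by simp [h])⟩

lemma mem_inv : x ∈ (inv A).1 ↔ ∀ a ∈ A.1, x * a ∈ (1 : FractionalIdeal R⁰ K) :=
  FractionalIdeal.mem_inv_iff A.2

end NonzeroFractionalIdeal

open NonzeroFractionalIdeal

variable (R K) in
/-- A (classical) star operation on the domain `R`. -/
@[ext]
structure StarOperation where
  /-- the map `A ↦ A^⋆` -/
  toFun : NonzeroFractionalIdeal R K → NonzeroFractionalIdeal R K
  map_principal : ∀ (x : K) (hx : x ≠ 0), toFun (principal x hx) = principal x hx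
  map_smul : ∀ (x : K) (hx : x ≠ 0) (A : NonzeroFractionalIdeal R K),
    toFun (smul x hx A) = smul x hx (toFun A)
  le_map : ∀ A : NonzeroFractionalIdeal R K, A ≤ toFun A
  mono : ∀ A B : NonzeroFractionalIdeal R K, A ≤ B → toFun A ≤ toFun B
  idem : ∀ A : NonzeroFractionalIdeal R K, toFun (toFun A) = toFun A

/-- A criterion used below to build star operations. -/
lemma map_smul_of_le (f : NonzeroFractionalIdeal R K → NonzeroFractionalIdeal R K)
    (h : ∀ (x : K) (hx : x ≠ 0) (A : NonzeroFractionalIdeal R K),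
      smul x hx (f A) ≤ f (smul x hx A))
    (x : K) (hx : x ≠ 0) (A : NonzeroFractionalIdeal R K) :
    f (smul x hx A) = smul x hx (f A) := by
  apply le_antisymm _ (h x hx A)
  have h1 := h x⁻¹ (inv_ne_zero hx) (smul x hx A)
  have h2 : smul x⁻¹ (inv_ne_zero hx) (smul x hx A) = A := by
    apply Subtype.ext
    simp only [smul, ← mul_assoc, FractionalIdeal.spanSingleton_mul_spanSingleton,
      inv_mul_cancel₀ hx, FractionalIdeal.spanSingleton_one, one_mul]
  rw [h2] at h1
  have h3 := smul_mono (x := x) (hx := hx) h1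
  rwa [smul_smul_inv] at h3

/-- Build a star operation from one-sided axioms. -/
def StarOperation.ofLE (f : NonzeroFractionalIdeal R K → NonzeroFractionalIdeal R K)
    (ring_le : f ring ≤ ring)
    (smul_le : ∀ (x : K) (hx : x ≠ 0) (A : NonzeroFractionalIdeal R K),
      smul x hx (f A) ≤ f (smul x hx A))
    (le_map : ∀ A, A ≤ f A) (mono : ∀ A B, A ≤ B → f A ≤ f B)
    (idem : ∀ A, f (f A) ≤ f A) : StarOperation R K where
  toFun := f
  map_smul := map_smul_of_le f smul_le
  map_principal x hx := by
    rw [← smul_ring, map_smul_of_le f smul_le, le_antisymm ring_le (le_map _)]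
  le_map := le_map
  mono := mono
  idem A := le_antisymm (idem A) (le_map _)

namespace StarOperation

lemma map_ring (star : StarOperation R K) : star.toFun ring = ring := by
  have h : (ring : NonzeroFractionalIdeal R K) = principal 1 one_ne_zero :=
    Subtype.ext FractionalIdeal.spanSingleton_one.symm
  rw [h, star.map_principal]

lemma mul_mem (star : StarOperation R K) {A B : NonzeroFractionalIdeal R K} {x : K}
    (hx : x ≠ 0) (h : ∀ a ∈ A.1, x * a ∈ B.1) {y : K} (hy : y ∈ (star.toFun A).1) :
    x * y ∈ (star.toFun B).1 := by
  have h1 := star.mono _ _ (smul_le (hx := hx).2 h)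
  rw [star.map_smul] at h1
  exact h1 (mul_mem_smul hy)

/-- The `v`-operation `A ↦ (A⁻¹)⁻¹`, where `A⁻¹ = (R : A)`. -/
noncomputable def v : StarOperation R K :=
  ofLE (fun A => inv (inv A))
    (by
      intro y hy
      have := mem_inv.1 hy 1 (mem_inv.2 fun a ha => by rw [one_mul]; exact ha)
      rw [mul_one] at this
      exact this)
    (by
      intro x hx A
      refine smul_le.2 fun a ha => mem_inv.2 fun b hb => ?_
      have := mem_inv.1 ha (x * b) (mem_inv.2 fun c hc => by
        have := mem_inv.1 hb _ (mul_mem_smul (x := x) (hx := hx) hc)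
        rwa [mul_comm x b, mul_assoc])
      rwa [mul_comm x a, mul_assoc])
    (fun A a ha => mem_inv.2 fun b hb => by
      rw [mul_comm]; exact mem_inv.1 hb a ha)
    (fun A B h a ha => mem_inv.2 fun b hb =>
      mem_inv.1 ha b (mem_inv.2 fun c hc => mem_inv.1 hb c (h hc)))
    (fun A a ha => mem_inv.2 fun b hb =>
      mem_inv.1 ha b (mem_inv.2 fun c hc => by
        rw [mul_comm]; exact mem_inv.1 hc b hb))

/-- The union of the `B^⋆`, with `B ⊆ A` a nonzero finitely generated fractional ideal. -/
noncomputable def finiteTypeClosure (star : StarOperation R K) (A : NonzeroFractionalIdeal R K) :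
    NonzeroFractionalIdeal R K :=
  have zero_case : ∃ B : NonzeroFractionalIdeal R K, (B.1 : Submodule R K).FG ∧ B ≤ A := by
    obtain ⟨a, ha, h0⟩ := exists_ne_zero A
    exact ⟨principal a h0, principal_fg a h0, principal_le ha⟩
  let S : Submodule R K :=
    { carrier := {x | ∃ B : NonzeroFractionalIdeal R K,
        (B.1 : Submodule R K).FG ∧ B ≤ A ∧ x ∈ (star.toFun B).1}
      zero_mem' := by
        obtain ⟨B, h1, h2⟩ := zero_case
        exact ⟨B, h1, h2, (star.toFun B).1.val.zero_mem⟩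
      add_mem' := by
        rintro x y ⟨B, h1, h2, h3⟩ ⟨C, h4, h5, h6⟩
        refine ⟨sum B C, ?_, ?_, (star.toFun (sum B C)).1.val.add_mem
          (star.mono B _ ?_ h3) (star.mono C _ ?_ h6)⟩
        · simp only [sum, FractionalIdeal.coe_sup]
          exact h1.sup h4
        · exact sup_le (show B.1 ≤ A.1 from h2) (show C.1 ≤ A.1 from h5)
        · exact (le_sup_left : B.1 ≤ B.1 ⊔ C.1)
        · exact (le_sup_right : C.1 ≤ B.1 ⊔ C.1)
      smul_mem' := by
        rintro r x ⟨B, h1, h2, h3⟩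
        exact ⟨B, h1, h2, (star.toFun B).1.val.smul_mem r h3⟩ }
  have hS : S ≤ ((star.toFun A).1 : Submodule R K) := by
    rintro x ⟨B, -, h2, h3⟩
    exact star.mono B A h2 h3
  ⟨⟨S, FractionalIdeal.isFractional_of_le (I := S) (J := (star.toFun A).1) hS⟩, by
    obtain ⟨a, ha, h0⟩ := exists_ne_zero A
    intro h
    have h1 : a ∈ S := ⟨principal a h0, principal_fg a h0, principal_le ha,
      star.le_map _ (FractionalIdeal.mem_spanSingleton_self R⁰ a)⟩
    have h2 : a ∈ (0 : FractionalIdeal R⁰ K) := by rw [← h]; exact h1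
    exact h0 (FractionalIdeal.mem_zero_iff R⁰ |>.1 h2)⟩

lemma mem_finiteTypeClosure {star : StarOperation R K} {A : NonzeroFractionalIdeal R K} {x : K} :
    x ∈ (star.finiteTypeClosure A).1 ↔ ∃ B : NonzeroFractionalIdeal R K,
      (B.1 : Submodule R K).FG ∧ B ≤ A ∧ x ∈ (star.toFun B).1 := Iff.rfl

lemma finiteTypeClosure_le (star : StarOperation R K) (A : NonzeroFractionalIdeal R K) :
    star.finiteTypeClosure A ≤ star.toFun A := by
  intro x hx
  obtain ⟨B, -, h2, h3⟩ := mem_finiteTypeClosure.1 hx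
  exact star.mono B A h2 h3

lemma smul_fg (x : K) (hx : x ≠ 0) {A : NonzeroFractionalIdeal R K}
    (h : (A.1 : Submodule R K).FG) : ((smul x hx A).1 : Submodule R K).FG := by
  simp only [smul, FractionalIdeal.coe_mul, FractionalIdeal.coe_spanSingleton]
  exact (Submodule.fg_span_singleton x).mul h

/-- A finitely generated fractional ideal below `A^{⋆_f}` is below some `B^⋆`, `B ⊆ A` finitely
generated. -/
lemma exists_of_le_finiteTypeClosure {star : StarOperation R K} {A B : NonzeroFractionalIdeal R K}
    (hB : (B.1 : Submodule R K).FG) (h : B ≤ star.finiteTypeClosure A) :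
    ∃ C : NonzeroFractionalIdeal R K, (C.1 : Submodule R K).FG ∧ C ≤ A ∧ B ≤ star.toFun C := by
  obtain ⟨s, hs⟩ := hB
  have key : ∀ t : Finset K, (∀ x ∈ t, x ∈ (star.finiteTypeClosure A).1) →
      ∃ C : NonzeroFractionalIdeal R K, (C.1 : Submodule R K).FG ∧ C ≤ A ∧
        ∀ x ∈ t, x ∈ (star.toFun C).1 := by
    classical
    intro t
    induction t using Finset.induction_on with
    | empty =>
      intro _
      obtain ⟨a, ha, h0⟩ := exists_ne_zero A
      exact ⟨principal a h0, principal_fg a h0, principal_le ha, by simp⟩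
    | insert a t _ ih =>
      intro ht
      obtain ⟨C, h1, h2, h3⟩ := ih fun x hx => ht x (Finset.mem_insert_of_mem hx)
      obtain ⟨D, h4, h5, h6⟩ := mem_finiteTypeClosure.1 (ht a (Finset.mem_insert_self a t))
      refine ⟨sum C D, ?_, sup_le (show C.1 ≤ A.1 from h2) (show D.1 ≤ A.1 from h5), ?_⟩
      · simp only [sum, FractionalIdeal.coe_sup]
        exact h1.sup h4
      · intro x hx
        rcases Finset.mem_insert.1 hx with rfl | hx
        · exact star.mono D _ (le_sup_right : D.1 ≤ C.1 ⊔ D.1) h6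
        · exact star.mono C _ (le_sup_left : C.1 ≤ C.1 ⊔ D.1) (h3 x hx)
  obtain ⟨C, h1, h2, h3⟩ := key s fun x hx => h (by
    have : x ∈ (B.1 : Submodule R K) := by rw [← hs]; exact Submodule.subset_span hx
    exact this)
  refine ⟨C, h1, h2, ?_⟩
  have : (B.1 : Submodule R K) ≤ ((star.toFun C).1 : Submodule R K) := by
    rw [← hs]; exact Submodule.span_le.2 h3
  exact this

/-- `⋆_f`, the star operation of finite type associated to `⋆`:
`A^{⋆_f}` is the union of the `B^⋆` over the nonzero finitely generated fractional `B ⊆ A`. -/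
noncomputable def finiteType (star : StarOperation R K) : StarOperation R K :=
  ofLE star.finiteTypeClosure
    ((finiteTypeClosure_le _ _).trans star.map_ring.le)
    (by
      intro x hx A
      refine smul_le.2 fun a ha => ?_
      obtain ⟨B, h1, h2, h3⟩ := mem_finiteTypeClosure.1 ha
      refine mem_finiteTypeClosure.2 ⟨smul x hx B, smul_fg x hx h1, smul_mono h2, ?_⟩
      rw [star.map_smul]
      exact mul_mem_smul h3)
    (by
      intro A a ha
      by_cases h0 : a = 0
      · subst h0; exact (star.finiteTypeClosure A).1.val.zero_mem
      · exact mem_finiteTypeClosure.2 ⟨principal a h0, principal_fg a h0, principal_le ha,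
          star.le_map _ (FractionalIdeal.mem_spanSingleton_self R⁰ a)⟩)
    (by
      intro A B h x hx
      obtain ⟨C, h1, h2, h3⟩ := mem_finiteTypeClosure.1 hx
      exact mem_finiteTypeClosure.2 ⟨C, h1, h2.trans h, h3⟩)
    (by
      intro A x hx
      obtain ⟨B, h1, h2, h3⟩ := mem_finiteTypeClosure.1 hx
      obtain ⟨C, h4, h5, h6⟩ := exists_of_le_finiteTypeClosure h1 h2
      refine mem_finiteTypeClosure.2 ⟨C, h4, h5, ?_⟩
      rw [← star.idem C]
      exact star.mono _ _ h6 h3)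

/-- The set of `J` over which `A^{⋆~}` is formed: nonzero finitely generated ideals `J ⊆ R` with
`J^⋆ = R`. -/
def IsTildeIdeal (star : StarOperation R K) (J : NonzeroFractionalIdeal R K) : Prop :=
  J ≤ ring ∧ (J.1 : Submodule R K).FG ∧ star.toFun J = ring

lemma isTildeIdeal_ring (star : StarOperation R K) : star.IsTildeIdeal ring := by
  refine ⟨le_rfl, ?_, star.map_ring⟩
  have := principal_fg (R := R) (1 : K) one_ne_zero
  simpa [principal, ring] using this

lemma IsTildeIdeal.prod {star : StarOperation R K} {I J : NonzeroFractionalIdeal R K}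
    (hI : star.IsTildeIdeal I) (hJ : star.IsTildeIdeal J) : star.IsTildeIdeal (prod I J) := by
  have hle : NonzeroFractionalIdeal.prod I J ≤ ring := by
    have := mul_le_mul' (show I.1 ≤ 1 from hI.1) (show J.1 ≤ 1 from hJ.1)
    rw [mul_one] at this
    exact this
  refine ⟨hle, ?_, le_antisymm ((star.mono _ _ hle).trans star.map_ring.le) ?_⟩
  · simp only [NonzeroFractionalIdeal.prod, FractionalIdeal.coe_mul]
    exact hI.2.1.mul hJ.2.1
  · have h1 : I ≤ star.toFun (NonzeroFractionalIdeal.prod I J) := by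
      intro x hx
      by_cases h0 : x = 0
      · subst h0; exact (star.toFun _).1.val.zero_mem
      · have := star.mul_mem (A := J) (B := NonzeroFractionalIdeal.prod I J) h0
          (fun a ha => FractionalIdeal.mul_mem_mul hx ha) (y := 1)
          (by rw [hJ.2.2]; exact one_mem_ring)
        rwa [mul_one] at this
    have h2 := star.mono _ _ h1
    rwa [hI.2.2, star.idem] at h2

/-- `{x ∈ K | xJ ⊆ A for some finitely generated ideal J ⊆ R with J^⋆ = R}`. -/
noncomputable def tildeClosure (star : StarOperation R K) (A : NonzeroFractionalIdeal R K) :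
    NonzeroFractionalIdeal R K :=
  let S : Submodule R K :=
    { carrier := {x | ∃ J : NonzeroFractionalIdeal R K,
        star.IsTildeIdeal J ∧ ∀ j ∈ J.1, x * j ∈ A.1}
      zero_mem' := ⟨ring, star.isTildeIdeal_ring, fun j _ => by
        rw [zero_mul]; exact A.1.val.zero_mem⟩
      add_mem' := by
        rintro x y ⟨I, h1, h2⟩ ⟨J, h3, h4⟩
        refine ⟨prod I J, h1.prod h3, fun k hk => ?_⟩
        rw [add_mul]
        refine A.1.val.add_mem (h2 k ?_) (h4 k ?_)
        · have := mul_le_mul_right (show J.1 ≤ 1 from h3.1) I.1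
          rw [mul_one] at this
          exact this hk
        · have := mul_le_mul_left (show I.1 ≤ 1 from h1.1) J.1
          rw [one_mul] at this
          exact this hk
      smul_mem' := by
        rintro r x ⟨I, h1, h2⟩
        exact ⟨I, h1, fun j hj => by
          rw [smul_mul_assoc]; exact A.1.val.smul_mem r (h2 j hj)⟩ }
  have hS : S ≤ ((star.toFun A).1 : Submodule R K) := by
    rintro x ⟨J, h1, h2⟩
    by_cases h0 : x = 0
    · subst h0; exact (star.toFun A).1.val.zero_mem
    · have := star.mul_mem h0 h2 (y := 1) (by rw [h1.2.2]; exact one_mem_ring)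
      rw [mul_one] at this
      exact this
  ⟨⟨S, FractionalIdeal.isFractional_of_le (I := S) (J := (star.toFun A).1) hS⟩, by
    obtain ⟨a, ha, h0⟩ := exists_ne_zero A
    intro h
    have h1 : a ∈ S := ⟨ring, star.isTildeIdeal_ring, fun j hj => by
      obtain ⟨r, rfl⟩ := (FractionalIdeal.mem_one_iff R⁰).1 hj
      rw [mul_comm, ← Algebra.smul_def]
      exact A.1.val.smul_mem r ha⟩
    have h2 : a ∈ (0 : FractionalIdeal R⁰ K) := by rw [← h]; exact h1
    exact h0 (FractionalIdeal.mem_zero_iff R⁰ |>.1 h2)⟩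

lemma mem_tildeClosure {star : StarOperation R K} {A : NonzeroFractionalIdeal R K} {x : K} :
    x ∈ (star.tildeClosure A).1 ↔ ∃ J : NonzeroFractionalIdeal R K,
      star.IsTildeIdeal J ∧ ∀ j ∈ J.1, x * j ∈ A.1 := Iff.rfl

lemma le_tildeClosure (star : StarOperation R K) (A : NonzeroFractionalIdeal R K) :
    A ≤ star.tildeClosure A := fun a ha =>
  mem_tildeClosure.2 ⟨ring, star.isTildeIdeal_ring, fun j hj => by
    obtain ⟨r, rfl⟩ := (FractionalIdeal.mem_one_iff R⁰).1 hj
    rw [mul_comm, ← Algebra.smul_def]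
    exact A.1.val.smul_mem r ha⟩

lemma tildeClosure_le (star : StarOperation R K) (A : NonzeroFractionalIdeal R K) :
    star.tildeClosure A ≤ star.toFun A := by
  intro x hx
  obtain ⟨J, h1, h2⟩ := mem_tildeClosure.1 hx
  by_cases h0 : x = 0
  · subst h0; exact (star.toFun A).1.val.zero_mem
  · have := star.mul_mem h0 h2 (y := 1) (by rw [h1.2.2]; exact one_mem_ring)
    rwa [mul_one] at this

/-- A single `J` works for all elements of a finitely generated submodule. -/
lemma exists_isTildeIdeal {star : StarOperation R K} {A B : NonzeroFractionalIdeal R K}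
    (hB : (B.1 : Submodule R K).FG) {x : K} (h : ∀ b ∈ B.1, x * b ∈ (star.tildeClosure A).1) :
    ∃ J : NonzeroFractionalIdeal R K, star.IsTildeIdeal J ∧
      ∀ b ∈ B.1, ∀ j ∈ J.1, x * b * j ∈ A.1 := by
  obtain ⟨s, hs⟩ := hB
  have key : ∀ t : Finset K, (∀ b ∈ t, x * b ∈ (star.tildeClosure A).1) →
      ∃ J : NonzeroFractionalIdeal R K, star.IsTildeIdeal J ∧
        ∀ b ∈ t, ∀ j ∈ J.1, x * b * j ∈ A.1 := by
    classical
    intro t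
    induction t using Finset.induction_on with
    | empty => exact fun _ => ⟨ring, star.isTildeIdeal_ring, by simp⟩
    | insert a t _ ih =>
      intro ht
      obtain ⟨I, h1, h2⟩ := ih fun b hb => ht b (Finset.mem_insert_of_mem hb)
      obtain ⟨J, h3, h4⟩ := mem_tildeClosure.1 (ht a (Finset.mem_insert_self a t))
      refine ⟨prod I J, h1.prod h3, fun b hb k hk => ?_⟩
      rcases Finset.mem_insert.1 hb with rfl | hb
      · have := mul_le_mul_left (show I.1 ≤ 1 from h1.1) J.1
        rw [one_mul] at this
        exact h4 k (this hk)
      · have := mul_le_mul_right (show J.1 ≤ 1 from h3.1) I.1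
        rw [mul_one] at this
        exact h2 b hb k (this hk)
  obtain ⟨J, h1, h2⟩ := key s fun b hb => h b (by
    have : b ∈ (B.1 : Submodule R K) := by rw [← hs]; exact Submodule.subset_span hb
    exact this)
  have aux : ∀ b ∈ Submodule.span R (s : Set K), ∀ j ∈ J.1, x * b * j ∈ A.1 := by
    intro b hb j hj
    induction hb using Submodule.span_induction with
    | mem b hb => exact h2 b hb j hj
    | zero => rw [mul_zero, zero_mul]; exact A.1.val.zero_mem
    | add a b _ _ iha ihb =>
      rw [mul_add, add_mul]
      exact A.1.val.add_mem iha ihb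
    | smul r b _ ihb =>
      rw [mul_smul_comm, smul_mul_assoc]
      exact A.1.val.smul_mem r ihb
  exact ⟨J, h1, fun b hb => aux b (by rw [hs]; exact hb)⟩

/-- The stable star operation of finite type `⋆~` associated to `⋆`:
`A^{⋆~} = {x ∈ K | xJ ⊆ A for some finitely generated ideal J ⊆ R with J^⋆ = R}`. -/
noncomputable def tilde (star : StarOperation R K) : StarOperation R K :=
  ofLE star.tildeClosure
    ((tildeClosure_le _ _).trans star.map_ring.le)
    (by
      intro x hx A
      refine smul_le.2 fun a ha => ?_
      obtain ⟨J, h1, h2⟩ := mem_tildeClosure.1 ha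
      refine mem_tildeClosure.2 ⟨J, h1, fun j hj => ?_⟩
      rw [mul_assoc]
      exact mul_mem_smul (h2 j hj))
    star.le_tildeClosure
    (by
      intro A B h x hx
      obtain ⟨J, h1, h2⟩ := mem_tildeClosure.1 hx
      exact mem_tildeClosure.2 ⟨J, h1, fun j hj => h (h2 j hj)⟩)
    (by
      intro A x hx
      obtain ⟨J, h1, h2⟩ := mem_tildeClosure.1 hx
      obtain ⟨I, h3, h4⟩ := exists_isTildeIdeal h1.2.1 h2
      refine mem_tildeClosure.2 ⟨prod J I, h1.prod h3, fun k hk => ?_⟩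
      refine FractionalIdeal.mul_induction_on (C := fun k => x * k ∈ A.1) hk
        (fun j hj i hi => ?_) (fun i j hi hj => ?_)
      · rw [← mul_assoc]; exact h4 j hj i hi
      · rw [mul_add]; exact A.1.val.add_mem hi hj)

/-- The `t`-operation `v_f`. -/
noncomputable def t : StarOperation R K := finiteType v

/-- The `w`-operation `v~`. -/
noncomputable def w : StarOperation R K := tilde v

end StarOperation

end Star

section Graded

open NonzeroFractionalIdeal

variable {Γ : Type*} [AddCancelCommMonoid Γ] [DecidableEq Γ]
  {R : Type*} [CommRing R] [IsDomain R] {K : Type*} [Field K] [Algebra R K] [IsFractionRing R K]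
  (𝒜 : Γ → AddSubgroup R) [GradedRing 𝒜]

/-- `s` belongs to `H`, the set of nonzero homogeneous elements of `R`. -/
def IsNonzeroHomogeneous (s : R) : Prop := s ≠ 0 ∧ SetLike.IsHomogeneousElem 𝒜 s

/-- `x ∈ K` is a nonzero homogeneous element of the homogeneous quotient field `R_H`; these are
exactly the fractions `a / s` with `a, s ∈ H`. -/
def IsNonzeroHomogeneousFraction (x : K) : Prop :=
  ∃ a s : R, IsNonzeroHomogeneous 𝒜 a ∧ IsNonzeroHomogeneous 𝒜 s ∧
    x = algebraMap R K a / algebraMap R K s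

variable {𝒜} in
lemma IsNonzeroHomogeneous.map_ne_zero {s : R} (hs : IsNonzeroHomogeneous 𝒜 s) :
    algebraMap R K s ≠ 0 :=
  (map_ne_zero_iff _ (IsFractionRing.injective R K)).2 hs.1

variable {𝒜} in
lemma IsNonzeroHomogeneousFraction.ne_zero {x : K} (hx : IsNonzeroHomogeneousFraction 𝒜 x) :
    x ≠ 0 := by
  obtain ⟨a, s, ha, hs, rfl⟩ := hx
  exact div_ne_zero ha.map_ne_zero hs.map_ne_zero

variable {𝒜} in
lemma IsNonzeroHomogeneous.mul {s u : R} (hs : IsNonzeroHomogeneous 𝒜 s)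
    (hu : IsNonzeroHomogeneous 𝒜 u) : IsNonzeroHomogeneous 𝒜 (s * u) :=
  ⟨mul_ne_zero hs.1 hu.1, hs.2.mul hu.2⟩

lemma isNonzeroHomogeneous_one : IsNonzeroHomogeneous 𝒜 1 :=
  ⟨one_ne_zero, SetLike.isHomogeneousElem_one 𝒜⟩

/-- A fractional ideal `A` is homogeneous if `sA` is a homogeneous integral ideal of `R` for some
nonzero homogeneous `s ∈ R`. -/
def IsHomogeneousFractional (A : NonzeroFractionalIdeal R K) : Prop :=
  ∃ (s : R) (hs : IsNonzeroHomogeneous 𝒜 s) (I : Ideal R), I.IsHomogeneous 𝒜 ∧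
    (smul (algebraMap R K s) hs.map_ne_zero A).1 = (I : FractionalIdeal R⁰ K)

variable (K) in
/-- `HF(R)`: the nonzero homogeneous fractional ideals of `R`. -/
abbrev HomogeneousFractionalIdeal :=
  {A : NonzeroFractionalIdeal R K // IsHomogeneousFractional 𝒜 A}

namespace HomogeneousFractionalIdeal

lemma isHomogeneousFractional_smul {x : K} (hx : IsNonzeroHomogeneousFraction 𝒜 x)
    {A : NonzeroFractionalIdeal R K} (hA : IsHomogeneousFractional 𝒜 A) :
    IsHomogeneousFractional 𝒜 (smul x hx.ne_zero A) := by
  have hx0 := hx.ne_zero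
  obtain ⟨a, u, ha, hu, rfl⟩ := hx
  obtain ⟨s, hs, I, hI, h⟩ := hA
  refine ⟨s * u, hs.mul hu, Ideal.span {a} * I,
    (Ideal.homogeneous_span 𝒜 _ (by rintro y rfl; exact ha.2)).mul hI, ?_⟩
  rw [FractionalIdeal.coeIdeal_mul, ← h, FractionalIdeal.coeIdeal_span_singleton]
  simp only [smul, ← mul_assoc, FractionalIdeal.spanSingleton_mul_spanSingleton]
  congr 2
  have := hu.map_ne_zero (K := K)
  rw [map_mul]
  field_simp

lemma isHomogeneousFractional_principal {x : K} (hx : IsNonzeroHomogeneousFraction 𝒜 x) :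
    IsHomogeneousFractional 𝒜 (principal x hx.ne_zero : NonzeroFractionalIdeal R K) := by
  rw [← smul_ring]
  refine isHomogeneousFractional_smul 𝒜 hx ⟨1, isNonzeroHomogeneous_one 𝒜, ⊤,
    Ideal.IsHomogeneous.top 𝒜, ?_⟩
  simp [smul, ring, FractionalIdeal.spanSingleton_one]

/-- The principal homogeneous fractional ideal `(x)`, `0 ≠ x ∈ R_H` homogeneous. -/
noncomputable def principal (x : K) (hx : IsNonzeroHomogeneousFraction 𝒜 x) :
    HomogeneousFractionalIdeal K 𝒜 :=
  ⟨NonzeroFractionalIdeal.principal x hx.ne_zero, isHomogeneousFractional_principal 𝒜 hx⟩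

/-- The homogeneous fractional ideal `xA`, `0 ≠ x ∈ R_H` homogeneous. -/
noncomputable def smul (x : K) (hx : IsNonzeroHomogeneousFraction 𝒜 x)
    (A : HomogeneousFractionalIdeal K 𝒜) : HomogeneousFractionalIdeal K 𝒜 :=
  ⟨NonzeroFractionalIdeal.smul x hx.ne_zero A.1, isHomogeneousFractional_smul 𝒜 hx A.2⟩

end HomogeneousFractionalIdeal

variable (K) in
/-- A homogeneous star operation on the graded domain `R`. -/
@[ext]
structure HomogeneousStarOperation where
  /-- the map `A ↦ A^⋆` -/
  toFun : HomogeneousFractionalIdeal K 𝒜 → HomogeneousFractionalIdeal K 𝒜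
  map_principal : ∀ (x : K) (hx : IsNonzeroHomogeneousFraction 𝒜 x),
    toFun (HomogeneousFractionalIdeal.principal 𝒜 x hx) =
      HomogeneousFractionalIdeal.principal 𝒜 x hx
  map_smul : ∀ (x : K) (hx : IsNonzeroHomogeneousFraction 𝒜 x)
    (A : HomogeneousFractionalIdeal K 𝒜),
    toFun (HomogeneousFractionalIdeal.smul 𝒜 x hx A) =
      HomogeneousFractionalIdeal.smul 𝒜 x hx (toFun A)
  le_map : ∀ A : HomogeneousFractionalIdeal K 𝒜, A ≤ toFun A
  mono : ∀ A B : HomogeneousFractionalIdeal K 𝒜, A ≤ B → toFun A ≤ toFun B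
  idem : ∀ A : HomogeneousFractionalIdeal K 𝒜, toFun (toFun A) = toFun A

/-- A star operation is homogeneous preserving if it sends homogeneous fractional ideals to
homogeneous ones. -/
def StarOperation.IsHomogeneousPreserving (star : StarOperation R K) : Prop :=
  ∀ A : NonzeroFractionalIdeal R K,
    IsHomogeneousFractional 𝒜 A → IsHomogeneousFractional 𝒜 (star.toFun A)

/-- The restriction to `HF(R)` of a homogeneous preserving star operation. -/
def StarOperation.restrict (star : StarOperation R K)
    (h : star.IsHomogeneousPreserving 𝒜) : HomogeneousStarOperation K 𝒜 where
  toFun A := ⟨star.toFun A.1, h A.1 A.2⟩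
  map_principal x hx := Subtype.ext (star.map_principal x hx.ne_zero)
  map_smul x hx A := Subtype.ext (star.map_smul x hx.ne_zero A.1)
  le_map A := star.le_map A.1
  mono A B hAB := star.mono A.1 B.1 hAB
  idem A := Subtype.ext (star.idem A.1)

/-- The integral ideal `A ∩ R`; it is `A` itself when `A ⊆ R`. -/
def integralPart (A : NonzeroFractionalIdeal R K) : Ideal R :=
  Submodule.comap (Algebra.linearMap R K) (A.1 : Submodule R K)

lemma coe_integralPart {A : NonzeroFractionalIdeal R K} (h : A ≤ ring) :
    (integralPart A : FractionalIdeal R⁰ K) = A.1 := by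
  ext x
  rw [FractionalIdeal.mem_coeIdeal]
  constructor
  · rintro ⟨r, hr, rfl⟩
    exact hr
  · intro hx
    obtain ⟨r, rfl⟩ := (FractionalIdeal.mem_one_iff R⁰).1 (h hx)
    exact ⟨r, hx, rfl⟩

/-- The content `C(A)` of a nonzero integral ideal `A ⊆ R`: the ideal of `R` generated by the
homogeneous components of all the elements of `A`. -/
noncomputable def content (A : NonzeroFractionalIdeal R K) (hA : A ≤ ring) :
    HomogeneousFractionalIdeal K 𝒜 :=
  ⟨⟨((integralPart A).homogeneousHull 𝒜).toIdeal, fun h => by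
      have h1 := FractionalIdeal.coeIdeal_eq_zero.1 h
      have h2 : integralPart A = ⊥ := le_bot_iff.1 ((Ideal.le_toIdeal_homogeneousHull 𝒜 _).trans h1.le)
      have h3 := coe_integralPart hA
      rw [h2, FractionalIdeal.coeIdeal_bot] at h3
      exact A.2 h3.symm⟩,
    1, isNonzeroHomogeneous_one 𝒜, _, ((integralPart A).homogeneousHull 𝒜).isHomogeneous, by
      simp [smul, FractionalIdeal.spanSingleton_one]⟩

section Content

variable {𝒜} {A B : NonzeroFractionalIdeal R K}

lemma content_le_ring (hA : A ≤ ring) : (content 𝒜 A hA).1 ≤ ring :=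
  FractionalIdeal.coeIdeal_le_one

lemma le_content (hA : A ≤ ring) : A ≤ (content 𝒜 A hA).1 := by
  have h := (FractionalIdeal.coeIdeal_le_coeIdeal K).2
    (Ideal.le_toIdeal_homogeneousHull 𝒜 (integralPart A))
  rw [coe_integralPart hA] at h
  exact h

lemma content_mono (hA : A ≤ ring) (hB : B ≤ ring) (h : A ≤ B) :
    content 𝒜 A hA ≤ content 𝒜 B hB :=
  (FractionalIdeal.coeIdeal_le_coeIdeal K).2
    (Ideal.homogeneousHull_mono 𝒜 (fun _ hx => h hx))

/-- The content of a homogeneous integral ideal is the ideal itself. -/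
lemma content_eq_self (hA : A ≤ ring) (h : IsHomogeneousFractional 𝒜 A) :
    content 𝒜 A hA = ⟨A, h⟩ := by
  apply Subtype.ext
  apply Subtype.ext
  change ((((integralPart A).homogeneousHull 𝒜).toIdeal : Ideal R) : FractionalIdeal R⁰ K) = A.1
  rw [Ideal.IsHomogeneous.toIdeal_homogeneousHull_eq_self, coe_integralPart hA]
  obtain ⟨s, hs, I, hI, e⟩ := h
  obtain ⟨hs0, i, hi⟩ := hs
  intro j x hx
  have h1 : algebraMap R K (s * x) ∈ (I : FractionalIdeal R⁰ K) := by
    rw [← e, map_mul]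
    exact mul_mem_smul hx
  obtain ⟨y, hy, hyx⟩ := (FractionalIdeal.mem_coeIdeal R⁰).1 h1
  have h2 : s * x ∈ I := by rwa [← IsFractionRing.injective R K hyx]
  have h3 := hI (i + j) h2
  rw [DirectSum.coe_decompose_mul_add_of_left_mem 𝒜 hi] at h3
  have h4 : algebraMap R K (s * (DirectSum.decompose 𝒜 x j : R)) ∈
      (I : FractionalIdeal R⁰ K) := (FractionalIdeal.mem_coeIdeal R⁰).2 ⟨_, h3, rfl⟩
  rw [← e, map_mul] at h4
  obtain ⟨b, hb, hb'⟩ := mem_smul.1 h4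
  have h5 := mul_left_cancel₀ (IsNonzeroHomogeneous.map_ne_zero (K := K) ⟨hs0, i, hi⟩) hb'
  change algebraMap R K (DirectSum.decompose 𝒜 x j : R) ∈ A.1
  rw [h5]
  exact hb

end Content

namespace HomogeneousStarOperation

variable {𝒜}

/-- For `0 ≠ z ∈ (R : A)`, the ideal `zA` is contained in `R`. -/
lemma smul_le_ring {A : NonzeroFractionalIdeal R K} {z : K} (hz : z ≠ 0) (hzA : z ∈ (inv A).1) :
    smul z hz A ≤ ring :=
  smul_le.2 (mem_inv.1 hzA)

/-- `⋂ {z⁻¹ C(zA)^⋆ | 0 ≠ z ∈ (R : A)}`, as an `R`-submodule of `K`. -/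
noncomputable def extensionSubmodule (star : HomogeneousStarOperation K 𝒜)
    (A : NonzeroFractionalIdeal R K) : Submodule R K :=
  ⨅ (z : K) (hz : z ≠ 0) (hzA : z ∈ (inv A).1),
    z⁻¹ • ((star.toFun (content 𝒜 (smul z hz A) (smul_le_ring hz hzA))).1.1 : Submodule R K)

lemma mem_extensionSubmodule {star : HomogeneousStarOperation K 𝒜}
    {A : NonzeroFractionalIdeal R K} {x : K} :
    x ∈ star.extensionSubmodule A ↔ ∀ (z : K) (hz : z ≠ 0) (hzA : z ∈ (inv A).1),
      z * x ∈ (star.toFun (content 𝒜 (smul z hz A) (smul_le_ring hz hzA))).1.1 := by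
  simp only [extensionSubmodule, Submodule.mem_iInf]
  refine forall_congr' fun z => forall_congr' fun hz => forall_congr' fun hzA => ?_
  constructor
  · intro h
    obtain ⟨y, hy, rfl⟩ := Submodule.mem_smul_pointwise_iff_exists _ _ _ |>.1 h
    rw [smul_eq_mul, mul_inv_cancel_left₀ hz]
    exact hy
  · intro h
    exact Submodule.mem_smul_pointwise_iff_exists _ _ _ |>.2
      ⟨_, h, by rw [smul_eq_mul, inv_mul_cancel_left₀ hz]⟩

lemma le_extensionSubmodule (star : HomogeneousStarOperation K 𝒜)
    (A : NonzeroFractionalIdeal R K) : (A.1 : Submodule R K) ≤ star.extensionSubmodule A :=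
  fun _ ha => mem_extensionSubmodule.2 fun _ hz hzA =>
    star.le_map _ (le_content (smul_le_ring hz hzA) (mul_mem_smul ha))

lemma isFractional_extensionSubmodule (star : HomogeneousStarOperation K 𝒜)
    (A : NonzeroFractionalIdeal R K) : IsFractional R⁰ (star.extensionSubmodule A) := by
  obtain ⟨z, hzA, hz⟩ := exists_ne_zero (inv A)
  refine FractionalIdeal.isFractional_of_le (J := (NonzeroFractionalIdeal.smul z⁻¹ (inv_ne_zero hz)
    (star.toFun (content 𝒜 (NonzeroFractionalIdeal.smul z hz A) (smul_le_ring hz hzA))).1).1) ?_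
  intro x hx
  exact mem_smul.2 ⟨_, mem_extensionSubmodule.1 hx z hz hzA, by rw [inv_mul_cancel_left₀ hz]⟩

/-- The fractional ideal `⋂ {z⁻¹ C(zA)^⋆ | 0 ≠ z ∈ (R : A)}`. -/
noncomputable def extensionFun (star : HomogeneousStarOperation K 𝒜)
    (A : NonzeroFractionalIdeal R K) : NonzeroFractionalIdeal R K :=
  ⟨⟨star.extensionSubmodule A, star.isFractional_extensionSubmodule A⟩, fun h => by
    obtain ⟨a, ha, h0⟩ := exists_ne_zero A
    have h1 : a ∈ (0 : FractionalIdeal R⁰ K) := by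
      rw [← h]; exact star.le_extensionSubmodule A ha
    exact h0 ((FractionalIdeal.mem_zero_iff R⁰).1 h1)⟩

lemma mem_extensionFun {star : HomogeneousStarOperation K 𝒜}
    {A : NonzeroFractionalIdeal R K} {x : K} :
    x ∈ (star.extensionFun A).1 ↔ ∀ (z : K) (hz : z ≠ 0) (hzA : z ∈ (inv A).1),
      z * x ∈ (star.toFun (content 𝒜 (NonzeroFractionalIdeal.smul z hz A)
        (smul_le_ring hz hzA))).1.1 :=
  mem_extensionSubmodule

/-- On an integral ideal, `A^{e(⋆)} ⊆ C(A)^⋆`. -/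
lemma extensionFun_le (star : HomogeneousStarOperation K 𝒜) {A : NonzeroFractionalIdeal R K}
    (hA : A ≤ ring) : star.extensionFun A ≤ (star.toFun (content 𝒜 A hA)).1 := by
  intro x hx
  have h := mem_extensionFun.1 hx 1 one_ne_zero
    (mem_inv.2 fun a ha => by rw [one_mul]; exact hA ha)
  have e : NonzeroFractionalIdeal.smul 1 one_ne_zero A = A :=
    Subtype.ext (by simp [NonzeroFractionalIdeal.smul, FractionalIdeal.spanSingleton_one])
  simp only [e, one_mul] at h
  exact h

lemma isHomogeneousFractional_ring :
    IsHomogeneousFractional 𝒜 (ring : NonzeroFractionalIdeal R K) :=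
  ⟨1, isNonzeroHomogeneous_one 𝒜, ⊤, Ideal.IsHomogeneous.top 𝒜, by
    simp [NonzeroFractionalIdeal.smul, ring, FractionalIdeal.spanSingleton_one]⟩

lemma le_ring_of_le_ring (star : HomogeneousStarOperation K 𝒜)
    {B : HomogeneousFractionalIdeal K 𝒜} (hB : B.1 ≤ ring) : (star.toFun B).1 ≤ ring := by
  have h1 := star.mono B ⟨ring, isHomogeneousFractional_ring⟩ hB
  have h2 : IsNonzeroHomogeneousFraction 𝒜 (1 : K) :=
    ⟨1, 1, isNonzeroHomogeneous_one 𝒜, isNonzeroHomogeneous_one 𝒜, by simp⟩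
  have h3 := star.map_principal 1 h2
  have h4 : HomogeneousFractionalIdeal.principal 𝒜 1 h2 = ⟨ring, isHomogeneousFractional_ring⟩ :=
    Subtype.ext (Subtype.ext FractionalIdeal.spanSingleton_one)
  rw [h4] at h3
  rw [h3] at h1
  exact h1

/-- Homogeneous integral ideals of the form `B^⋆` are closed under `e(⋆)`. -/
lemma extensionFun_closed (star : HomogeneousStarOperation K 𝒜)
    {B : HomogeneousFractionalIdeal K 𝒜} (hB : B.1 ≤ ring) :
    star.extensionFun (star.toFun B).1 ≤ (star.toFun B).1 := by
  have h := star.extensionFun_le (star.le_ring_of_le_ring hB)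
  rw [content_eq_self _ (star.toFun B).2] at h
  exact h.trans (star.idem B).le

lemma extensionFun_mono (star : HomogeneousStarOperation K 𝒜) (A B : NonzeroFractionalIdeal R K)
    (h : A ≤ B) : star.extensionFun A ≤ star.extensionFun B := by
  intro x hx
  refine mem_extensionFun.2 fun z hz hzB => ?_
  have hzA : z ∈ (inv A).1 := mem_inv.2 fun a ha => mem_inv.1 hzB a (h ha)
  exact star.mono _ _ (content_mono (smul_le_ring hz hzA) (smul_le_ring hz hzB) (smul_mono h))
    (mem_extensionFun.1 hx z hz hzA)

lemma smul_extensionFun_le (star : HomogeneousStarOperation K 𝒜) (x : K) (hx : x ≠ 0)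
    (A : NonzeroFractionalIdeal R K) :
    NonzeroFractionalIdeal.smul x hx (star.extensionFun A) ≤
      star.extensionFun (NonzeroFractionalIdeal.smul x hx A) := by
  refine smul_le.2 fun a ha => mem_extensionFun.2 fun z hz hzA => ?_
  have e : NonzeroFractionalIdeal.smul z hz (NonzeroFractionalIdeal.smul x hx A) =
      NonzeroFractionalIdeal.smul (z * x) (mul_ne_zero hz hx) A :=
    Subtype.ext (by
      simp only [NonzeroFractionalIdeal.smul, ← mul_assoc,
        FractionalIdeal.spanSingleton_mul_spanSingleton])
  have h1 : z * x ∈ (inv A).1 := mem_inv.2 fun b hb => by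
    rw [mul_assoc]; exact mem_inv.1 hzA _ (mul_mem_smul hb)
  have h2 := mem_extensionFun.1 ha (z * x) (mul_ne_zero hz hx) h1
  rw [← mul_assoc]
  simp only [e]
  exact h2

/-- The extension `e(⋆)` of a homogeneous star operation `⋆` to a (classical) star operation:
`A^{e(⋆)} = ⋂ {z⁻¹ C(zA)^⋆ | 0 ≠ z ∈ (R : A)}`. -/
noncomputable def extension (star : HomogeneousStarOperation K 𝒜) : StarOperation R K :=
  StarOperation.ofLE star.extensionFun
    ((star.extensionFun_le le_rfl).trans (star.le_ring_of_le_ring (content_le_ring le_rfl)))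
    star.smul_extensionFun_le
    star.le_extensionSubmodule
    star.extensionFun_mono
    (by
      intro A x hx
      refine mem_extensionFun.2 fun z hz hzA => ?_
      have h1 : NonzeroFractionalIdeal.smul z hz (star.extensionFun A) ≤
          (star.toFun (content 𝒜 (NonzeroFractionalIdeal.smul z hz A)
            (smul_le_ring hz hzA))).1 :=
        smul_le.2 fun a ha => mem_extensionFun.1 ha z hz hzA
      exact star.extensionFun_closed (content_le_ring _) (star.extensionFun_mono _ _ h1
        (star.smul_extensionFun_le z hz _ (mul_mem_smul hx))))

end HomogeneousStarOperation

end Graded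

end GradedDomain

namespace GradedDomain

open scoped nonZeroDivisors Pointwise

/-! Order star operations pointwise; all the equalities then come from two inequalities. For every
homogeneous star operation, e(⋆) ≤ v (`extension_le_v`): C(zA) ⊆ R forces C(zA)^⋆ ⊆ R, so z·A^{e(⋆)}
⊆ R for all z in (R : A). For every homogeneous preserving ⋆, ⋆ ≤ e(⋆) (`le_extension_restrict`):
z·A^⋆ = (zA)^⋆ ⊆ C(zA)^⋆. Hence v ≤ e(v) ≤ v. Since ⋆ ↦ ⋆_f is monotone, t ≤ t_f ≤ e(t)_f ≤ v_f = t,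
and the same chain with ⋆~ in place of ⋆_f gives w.

What remains is that v, t and w preserve homogeneity, which may be tested on integral ideals. For v,
if a ≠ 0 is a homogeneous element of I, then I^v = (aR : (aR : I)), and colons of homogeneous ideals
are homogeneous. For t, a finitely generated B inside a homogeneous A may be replaced by C(B), which
is still finitely generated and still inside A.

For w, xJ ⊆ I has to say something about the components of x. A statement of Dedekind–Mertens type
does it: C(J)^m multiplies every component of x into I for some m
(`exists_homogeneousHull_pow_mul_mem`), and C(J)^m is again finitely generated with v-closure R. It
rests on `exists_pow_component_mul_mem`, an induction on the number of components of two factors;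
torsion-freeness enters there, supplying a degree a + b reached by a single pair of components. -/

/-- Torsion-free commutative cancellative additive monoids have unique sums. -/
lemma exists_uniqueAdd {Γ : Type*} [AddCancelCommMonoid Γ] [IsAddTorsionFree Γ]
    {S T : Finset Γ} (hS : S.Nonempty) (hT : T.Nonempty) :
    ∃ a ∈ S, ∃ b ∈ T, UniqueAdd S T a b := by
  classical
  -- Only finitely many degrees matter. The submonoid they generate is finitely generated,
  -- cancellative and torsion-free, that is, an affine monoid, and these have unique sums.
  let M : AddSubmonoid Γ := AddSubmonoid.closure ((S ∪ T : Finset Γ) : Set Γ)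
  have hfg : AddMonoid.FG M :=
    (AddMonoid.fg_iff_addSubmonoid_fg M).2 ⟨S ∪ T, rfl⟩
  have htf : IsAddTorsionFree M :=
    ⟨fun n hn x y hxy => Subtype.ext (nsmul_right_injective hn (congrArg Subtype.val hxy))⟩
  let _ : AddCancelCommMonoid M :=
    { (inferInstance : AddCommMonoid M) with
      add_left_cancel := fun a b c h => Subtype.ext (add_left_cancel (congrArg Subtype.val h)) }
  have htu : TwoUniqueSums M := AffineAddMonoid.to_twoUniqueSums
  have hSM : ∀ a ∈ S, a ∈ M := fun a ha => AddSubmonoid.subset_closure (by simp [ha])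
  have hTM : ∀ a ∈ T, a ∈ M := fun a ha => AddSubmonoid.subset_closure (by simp [ha])
  obtain ⟨a₀, ha₀⟩ := hS
  obtain ⟨b₀, hb₀⟩ := hT
  obtain ⟨a, ha, b, hb, h⟩ := UniqueSums.uniqueAdd_of_nonempty
    (A := S.subtype (· ∈ M)) (B := T.subtype (· ∈ M))
    ⟨⟨a₀, hSM _ ha₀⟩, Finset.mem_subtype.2 ha₀⟩ ⟨⟨b₀, hTM _ hb₀⟩, Finset.mem_subtype.2 hb₀⟩
  refine ⟨a, Finset.mem_subtype.1 ha, b, Finset.mem_subtype.1 hb, fun c d hc hd hcd => ?_⟩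
  have := @h ⟨c, hSM c hc⟩ ⟨d, hTM d hd⟩ (Finset.mem_subtype.2 hc) (Finset.mem_subtype.2 hd)
    (Subtype.ext hcd)
  exact ⟨congrArg Subtype.val this.1, congrArg Subtype.val this.2⟩

/-! ### Homogeneous ideals and components of products -/

section GradedRing

variable {Γ : Type*} [AddCancelCommMonoid Γ] [DecidableEq Γ]
  {R : Type*} [CommRing R] {𝒜 : Γ → AddSubgroup R} [GradedRing 𝒜]

lemma sum_decompose (x : R) : ∃ S : Finset Γ, ∑ i ∈ S, (DirectSum.decompose 𝒜 x i : R) = x ∧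
    ∀ i ∉ S, (DirectSum.decompose 𝒜 x i : R) = 0 := by
  classical
  refine ⟨(DirectSum.decompose 𝒜 x).support, DirectSum.sum_support_decompose 𝒜 x, fun i hi => ?_⟩
  rw [DFinsupp.notMem_support_iff.1 hi]
  rfl

/-- Colon ideals of homogeneous ideals are homogeneous. -/
lemma isHomogeneous_colon {I J : Ideal R} (hI : I.IsHomogeneous 𝒜) (hJ : J.IsHomogeneous 𝒜) :
    (I.colon (J : Set R)).IsHomogeneous 𝒜 := by
  intro i x hx
  rw [Submodule.mem_colon] at hx ⊢
  intro y hy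
  obtain ⟨S, hS, -⟩ := sum_decompose (𝒜 := 𝒜) y
  rw [← hS, smul_eq_mul, Finset.mul_sum]
  refine Ideal.sum_mem _ fun j _ => ?_
  -- By cancellation in Γ, x_i y_j is the component of x y_j in degree i + j.
  have := hI (i + j) (hx _ (hJ j hy))
  rwa [smul_eq_mul, DirectSum.coe_decompose_mul_add_of_right_mem 𝒜 (SetLike.coe_mem _)] at this

/-- The homogeneous hull of the ideal generated by `s` is generated by the homogeneous components
of the elements of `s`. -/
lemma homogeneousHull_span (s : Set R) :
    ((Ideal.span s).homogeneousHull 𝒜).toIdeal =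
      Ideal.span {y | ∃ x ∈ s, ∃ i, y = (DirectSum.decompose 𝒜 x i : R)} := by
  apply le_antisymm
  · have hom : (Ideal.span {y | ∃ x ∈ s, ∃ i, y = (DirectSum.decompose 𝒜 x i : R)}).IsHomogeneous
        𝒜 := Ideal.homogeneous_span 𝒜 _ (by
      rintro y ⟨x, -, i, rfl⟩
      exact ⟨i, SetLike.coe_mem _⟩)
    have := (Ideal.homogeneousHull.gc 𝒜 (Ideal.span s) ⟨_, hom⟩).2 (Ideal.span_le.2 fun x hx => by
      obtain ⟨S, hS, -⟩ := sum_decompose (𝒜 := 𝒜) x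
      change x ∈ Ideal.span _
      rw [← hS]
      exact Ideal.sum_mem _ fun i _ => Ideal.subset_span ⟨x, hx, i, rfl⟩)
    exact this
  · refine Ideal.span_le.2 ?_
    rintro y ⟨x, hx, i, rfl⟩
    exact ((Ideal.span s).homogeneousHull 𝒜).isHomogeneous i
      (Ideal.le_toIdeal_homogeneousHull 𝒜 _ (Ideal.subset_span hx))

/-- The homogeneous hull of a finitely generated ideal is finitely generated. -/
lemma homogeneousHull_fg {I : Ideal R} (hI : I.FG) : ((I.homogeneousHull 𝒜).toIdeal).FG := by
  classical
  obtain ⟨s, rfl⟩ := hI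
  choose S hS hS' using sum_decompose (𝒜 := 𝒜) (R := R)
  rw [homogeneousHull_span]
  -- The generator 0 accounts for the components outside the finite supports.
  refine ⟨insert 0 (s.biUnion fun x => (S x).image fun i => (DirectSum.decompose 𝒜 x i : R)), ?_⟩
  apply le_antisymm
  · refine Submodule.span_le.2 fun y hy => ?_
    simp only [Finset.coe_insert, Finset.coe_biUnion, Set.mem_insert_iff, Finset.coe_image,
      Set.mem_iUnion, Set.mem_image, Finset.mem_coe] at hy
    obtain rfl | ⟨x, hx, i, -, rfl⟩ := hy
    · exact zero_mem _
    · exact Ideal.subset_span ⟨x, hx, i, rfl⟩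
  · refine Ideal.span_le.2 ?_
    rintro y ⟨x, hx, i, rfl⟩
    refine Submodule.subset_span ?_
    simp only [Finset.coe_insert, Finset.coe_biUnion, Set.mem_insert_iff, Finset.coe_image,
      Set.mem_iUnion, Set.mem_image, Finset.mem_coe]
    by_cases hi : i ∈ S x
    · exact Or.inr ⟨x, hx, i, hi, rfl⟩
    · exact Or.inl (hS' x i hi)

/-- Any other pair of degrees with sum a + b leaves S or T, so its product vanishes and one term
survives. -/
lemma decompose_mul_of_uniqueAdd {f x : R} {S T : Finset Γ}
    (hf : ∀ i ∉ S, (DirectSum.decompose 𝒜 f i : R) = 0)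
    (hx : ∀ i ∉ T, (DirectSum.decompose 𝒜 x i : R) = 0) {a b : Γ} (h : UniqueAdd S T a b) :
    (DirectSum.decompose 𝒜 (f * x) (a + b) : R) =
      (DirectSum.decompose 𝒜 f a : R) * (DirectSum.decompose 𝒜 x b : R) := by
  classical
  rw [DirectSum.decompose_mul, DirectSum.coe_mul_apply]
  refine Finset.sum_eq_single (a, b) ?_ ?_
  · rintro ⟨c, d⟩ hcd hne
    by_cases hc : c ∈ S
    · by_cases hd : d ∈ T
      · obtain ⟨rfl, rfl⟩ := h hc hd (Finset.mem_filter.1 hcd).2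
        exact absurd rfl hne
      · rw [hx d hd, mul_zero]
    · rw [hf c hc, zero_mul]
  · intro hab
    simp only [Finset.mem_filter, Finset.mem_product, DFinsupp.mem_support_toFun, and_true,
      not_and_or, not_not] at hab
    rcases hab with h0 | h0 <;> rw [h0] <;> simp

lemma decompose_sub_component (x : R) (a i : Γ) :
    (DirectSum.decompose 𝒜 (x - (DirectSum.decompose 𝒜 x a : R)) i : R) =
      if i = a then 0 else (DirectSum.decompose 𝒜 x i : R) := by
  rw [DirectSum.decompose_sub, DirectSum.sub_apply, AddSubgroupClass.coe_sub]
  split_ifs with h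
  · subst h
    rw [DirectSum.decompose_of_mem_same 𝒜 (SetLike.coe_mem _), sub_self]
  · rw [DirectSum.decompose_of_mem_ne 𝒜 (SetLike.coe_mem _) (Ne.symm h), sub_zero]

/-- A homogeneous factor only translates the support, so the bound on the number of components does
not grow; the induction below counts on this. -/
lemma decompose_homogeneous_mul_eq_zero {c x : R} {a : Γ} (hc : c ∈ 𝒜 a) {T : Finset Γ}
    (hx : ∀ i ∉ T, (DirectSum.decompose 𝒜 x i : R) = 0) :
    ∀ i ∉ T.image (a + ·), (DirectSum.decompose 𝒜 (c * x) i : R) = 0 := by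
  intro i hi
  obtain ⟨S, hS, hS'⟩ := sum_decompose (𝒜 := 𝒜) x
  rw [← hS, Finset.mul_sum, DirectSum.decompose_sum, DFinsupp.finsetSum_apply,
    AddSubmonoidClass.coe_finsetSum]
  refine Finset.sum_eq_zero fun j _ => ?_
  by_cases hj : j ∈ T
  · exact DirectSum.decompose_of_mem_ne 𝒜 (SetLike.mul_mem_graded hc (SetLike.coe_mem _))
      fun h => hi (Finset.mem_image.2 ⟨j, hj, h⟩)
  · rw [hx j hj, mul_zero, DirectSum.decompose_zero]
    rfl

/-! ### A Dedekind–Mertens type statement for homogeneous ideals -/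

variable [IsAddTorsionFree Γ]

/-- If `f * x` lies in a homogeneous ideal `I`, then every homogeneous component of `f` has a power
multiplying all homogeneous components of `x` into `I`. -/
lemma exists_pow_component_mul_mem {I : Ideal R} (hI : I.IsHomogeneous 𝒜) {f x : R}
    (h : f * x ∈ I) (j : Γ) : ∃ m : ℕ, ∀ i,
      (DirectSum.decompose 𝒜 f j : R) ^ m * (DirectSum.decompose 𝒜 x i : R) ∈ I := by
  -- S and T need only contain the supports of f and x. Induction on |S| + |T| allows either factor
  -- to lose a component while being multiplied by homogeneous elements.
  suffices key : ∀ (n : ℕ) (S T : Finset Γ), S.card + T.card ≤ n → ∀ f x : R,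
      (∀ i ∉ S, (DirectSum.decompose 𝒜 f i : R) = 0) →
      (∀ i ∉ T, (DirectSum.decompose 𝒜 x i : R) = 0) → f * x ∈ I → ∀ j, ∃ m : ℕ, ∀ i,
        (DirectSum.decompose 𝒜 f j : R) ^ m * (DirectSum.decompose 𝒜 x i : R) ∈ I by
    obtain ⟨S, -, hS⟩ := sum_decompose (𝒜 := 𝒜) f
    obtain ⟨T, -, hT⟩ := sum_decompose (𝒜 := 𝒜) x
    exact key _ S T le_rfl f x hS hT h j
  clear h j f x
  intro n
  induction n with
  | zero =>
    intro S T hn f x hf hx h j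
    have hT : T = ∅ := Finset.card_eq_zero.1 (by omega)
    exact ⟨0, fun i => by rw [hx i (by simp [hT]), mul_zero]; exact I.zero_mem⟩
  | succ n ih =>
    intro S T hn f x hf hx h j
    rcases T.eq_empty_or_nonempty with rfl | hT
    · exact ⟨0, fun i => by rw [hx i (by simp), mul_zero]; exact I.zero_mem⟩
    rcases S.eq_empty_or_nonempty with rfl | hS
    · exact ⟨1, fun i => by rw [hf j (by simp), pow_one, zero_mul]; exact I.zero_mem⟩
    obtain ⟨a, ha, b, hb, hab⟩ := exists_uniqueAdd hS hT
    set c : R := (DirectSum.decompose 𝒜 f a : R) with hc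
    have hca : c ∈ 𝒜 a := SetLike.coe_mem _
    set y : R := x - (DirectSum.decompose 𝒜 x b : R) with hy
    -- By uniqueness of the sum, f_a x_b is a full component of f x, hence lies in the homogeneous
    -- ideal I.
    have hcb : c * (DirectSum.decompose 𝒜 x b : R) ∈ I := by
      rw [← decompose_mul_of_uniqueAdd hf hx hab]
      exact hI _ h
    have hcomp : ∀ i, (DirectSum.decompose 𝒜 (c * y) (a + i) : R) =
        c * if i = b then 0 else (DirectSum.decompose 𝒜 x i : R) := fun i => by
      rw [DirectSum.coe_decompose_mul_add_of_left_mem 𝒜 hca, hy, decompose_sub_component]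
    have hfy : f * (c * y) ∈ I := by
      have : f * (c * y) = c * (f * x) - f * (c * (DirectSum.decompose 𝒜 x b : R)) := by
        rw [hy]; ring
      rw [this]
      exact I.sub_mem (I.mul_mem_left _ h) (I.mul_mem_left _ hcb)
    -- Since f · (c y) is in I and c y has lost the component of degree b, induction applies to f
    -- and c y; degree b itself is covered by c x_b in I.
    have hstep : ∀ j, ∃ m : ℕ, ∀ i, (DirectSum.decompose 𝒜 f j : R) ^ m *
        (c * (DirectSum.decompose 𝒜 x i : R)) ∈ I := by
      intro j
      obtain ⟨m, hm⟩ := ih S ((T.erase b).image (a + ·)) (by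
        have h1 := Finset.card_image_le (s := T.erase b) (f := (a + ·))
        have h2 := Finset.card_erase_add_one hb
        omega) f (c * y) hf
        (decompose_homogeneous_mul_eq_zero hca fun i hi => by
          rw [hy, decompose_sub_component]
          split_ifs with hib
          · rfl
          · exact hx i fun hiT => hi (Finset.mem_erase.2 ⟨hib, hiT⟩)) hfy j
      refine ⟨m, fun i => ?_⟩
      by_cases hib : i = b
      · rw [hib]
        exact I.mul_mem_left _ hcb
      · have := hm (a + i)
        rwa [hcomp, if_neg hib] at this
    -- For j = a the extra factor c = f_a is one more power. For j ≠ a, with p = f_j^m, p c x lies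
    -- in I, so (f - c)(p x) does too; now f has lost a component, and f - c still has f_j in degree
    -- j.
    by_cases hja : j = a
    · obtain ⟨m, hm⟩ := hstep a
      refine ⟨m + 1, fun i => ?_⟩
      rw [hja, pow_succ, mul_assoc]
      exact hm i
    · obtain ⟨m, hm⟩ := hstep j
      set p : R := (DirectSum.decompose 𝒜 f j : R) ^ m with hp
      have hpm : p ∈ 𝒜 (m • j) := SetLike.pow_mem_graded m (SetLike.coe_mem _)
      have hpcx : p * (c * x) ∈ I := by
        obtain ⟨U, hU, -⟩ := sum_decompose (𝒜 := 𝒜) x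
        rw [← hU, Finset.mul_sum, Finset.mul_sum]
        exact Ideal.sum_mem _ fun i _ => hm i
      obtain ⟨k, hk⟩ := ih (S.erase a) (T.image (m • j + ·)) (by
        have h1 := Finset.card_image_le (s := T) (f := (m • j + ·))
        have h2 := Finset.card_erase_add_one ha
        omega) (f - c) (p * x) (fun i hi => by
          rw [hc, decompose_sub_component]
          split_ifs with hia
          · rfl
          · exact hf i fun hiS => hi (Finset.mem_erase.2 ⟨hia, hiS⟩))
        (decompose_homogeneous_mul_eq_zero hpm hx) (by
          have : (f - c) * (p * x) = p * (f * x) - p * (c * x) := by ring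
          rw [this]
          exact I.sub_mem (I.mul_mem_left _ h) hpcx) j
      refine ⟨k + m, fun i => ?_⟩
      have := hk (m • j + i)
      rwa [DirectSum.coe_decompose_mul_add_of_left_mem 𝒜 hpm, hc, decompose_sub_component,
        if_neg hja, hp, ← mul_assoc, ← pow_add] at this

/-- If `J` is a finitely generated ideal with `xJ ⊆ I` and `I` is homogeneous, then some power of
the homogeneous hull of `J` multiplies all homogeneous components of `x` into `I`. -/
lemma exists_homogeneousHull_pow_mul_mem {I J : Ideal R} (hI : I.IsHomogeneous 𝒜) (hJ : J.FG)
    {x : R} (h : ∀ j ∈ J, x * j ∈ I) : ∃ m : ℕ, ∀ i,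
      ∀ c ∈ (J.homogeneousHull 𝒜).toIdeal ^ m, (DirectSum.decompose 𝒜 x i : R) * c ∈ I := by
  -- Each component of each element of J has a power in Q. As the hull of J is finitely generated,
  -- one power of the whole hull lies in Q.
  let Q : Ideal R := I.colon (Set.range fun i => (DirectSum.decompose 𝒜 x i : R))
  have hQ : (J.homogeneousHull 𝒜).toIdeal ≤ Q.radical := by
    have hspan : Ideal.span (J : Set R) = J := Ideal.span_eq J
    rw [← hspan, homogeneousHull_span]
    refine Ideal.span_le.2 ?_
    rintro y ⟨f, hf, j, rfl⟩
    obtain ⟨m, hm⟩ := exists_pow_component_mul_mem hI (f := f) (x := x)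
      (by rw [mul_comm]; exact h f hf) j
    refine ⟨m, Submodule.mem_colon.2 ?_⟩
    rintro _ ⟨i, rfl⟩
    exact hm i
  obtain ⟨m, hm⟩ := Ideal.exists_pow_le_of_le_radical_of_fg hQ (homogeneousHull_fg hJ)
  refine ⟨m, fun i c hc => ?_⟩
  rw [mul_comm]
  exact Submodule.mem_colon.1 (hm hc) _ ⟨i, rfl⟩

end GradedRing

open NonzeroFractionalIdeal

/-! ### The order on star operations, and monotonicity of ⋆_f and ⋆~ -/

section Star

variable {R : Type*} [CommRing R] [IsDomain R] {K : Type*} [Field K] [Algebra R K]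
  [IsFractionRing R K]

lemma mem_integralPart {A : NonzeroFractionalIdeal R K} {r : R} :
    r ∈ integralPart A ↔ algebraMap R K r ∈ A.1 := Iff.rfl

lemma integralPart_fg {A : NonzeroFractionalIdeal R K} (hA : A ≤ ring) :
    (integralPart A).FG ↔ (A.1 : Submodule R K).FG := by
  rw [← coe_integralPart hA, FractionalIdeal.coeIdeal_fg R⁰ (IsFractionRing.injective R K)]

namespace StarOperation

lemma map_le_ring (star : StarOperation R K) {A : NonzeroFractionalIdeal R K} (hA : A ≤ ring) :
    star.toFun A ≤ ring :=
  (star.mono _ _ hA).trans star.map_ring.le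

lemma IsTildeIdeal.pow {star : StarOperation R K} {J : NonzeroFractionalIdeal R K}
    (hJ : star.IsTildeIdeal J) (n : ℕ) :
    ∃ D : NonzeroFractionalIdeal R K, star.IsTildeIdeal D ∧ D.1 = J.1 ^ n := by
  induction n with
  | zero => exact ⟨ring, star.isTildeIdeal_ring, (pow_zero _).symm⟩
  | succ n ih =>
    obtain ⟨D, hD, h⟩ := ih
    exact ⟨_, hD.prod hJ, by rw [pow_succ, ← h]; rfl⟩

instance : PartialOrder (StarOperation R K) where
  le s u := ∀ A, s.toFun A ≤ u.toFun A
  le_refl _ _ := le_rfl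
  le_trans _ _ _ h k A := (h A).trans (k A)
  le_antisymm _ _ h k := StarOperation.ext (funext fun A => le_antisymm (h A) (k A))

lemma finiteType_mono {s u : StarOperation R K} (h : s ≤ u) : s.finiteType ≤ u.finiteType := by
  intro A x hx
  obtain ⟨B, h1, h2, h3⟩ := mem_finiteTypeClosure.1 hx
  exact mem_finiteTypeClosure.2 ⟨B, h1, h2, h B h3⟩

/-- A finitely generated B is among the ideals that define its own B^{⋆_f}, so B^⋆ ⊆ B^{⋆_f}. Only
this half of idempotence is needed. -/
lemma le_finiteType_finiteType (s : StarOperation R K) :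
    s.finiteType ≤ s.finiteType.finiteType := by
  intro A x hx
  obtain ⟨B, h1, h2, h3⟩ := mem_finiteTypeClosure.1 hx
  exact mem_finiteTypeClosure.2 ⟨B, h1, h2, mem_finiteTypeClosure.2 ⟨B, h1, le_rfl, h3⟩⟩

lemma tilde_mono {s u : StarOperation R K} (h : s ≤ u) : s.tilde ≤ u.tilde := by
  intro A x hx
  obtain ⟨J, ⟨h1, h2, h3⟩, h4⟩ := mem_tildeClosure.1 hx
  exact mem_tildeClosure.2 ⟨J, ⟨h1, h2, le_antisymm (u.map_le_ring h1) (h3.ge.trans (h J))⟩, h4⟩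

/-- The ideals J that test ⋆~ also test its iterate: if J^⋆ = R, then 1·J ⊆ J puts 1 in J^{⋆~}. -/
lemma le_tilde_tilde (s : StarOperation R K) : s.tilde ≤ s.tilde.tilde := by
  intro A x hx
  obtain ⟨J, hJ, h4⟩ := mem_tildeClosure.1 hx
  refine mem_tildeClosure.2 ⟨J, ⟨hJ.1, hJ.2.1, ?_⟩, h4⟩
  exact le_antisymm (s.tilde.map_le_ring hJ.1)
    (ring_le (mem_tildeClosure.2 ⟨J, hJ, fun j hj => by rwa [one_mul]⟩))

end StarOperation

end Star

/-! ### Preservation of homogeneity by v, t and w -/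

section Graded

variable {Γ : Type*} [AddCancelCommMonoid Γ] [DecidableEq Γ]
  {R : Type*} [CommRing R] [IsDomain R] {K : Type*} [Field K] [Algebra R K] [IsFractionRing R K]
  {𝒜 : Γ → AddSubgroup R} [GradedRing 𝒜]

lemma integralPart_content {A : NonzeroFractionalIdeal R K} (hA : A ≤ ring) :
    integralPart (content 𝒜 A hA).1 = ((integralPart A).homogeneousHull 𝒜).toIdeal :=
  FractionalIdeal.coeIdeal_injective (K := K) (coe_integralPart (content_le_ring hA))

lemma content_fg {A : NonzeroFractionalIdeal R K} (hA : A ≤ ring)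
    (h : (A.1 : Submodule R K).FG) : ((content 𝒜 A hA).1.1 : Submodule R K).FG := by
  rw [← integralPart_fg (content_le_ring hA), integralPart_content]
  exact homogeneousHull_fg ((integralPart_fg hA).2 h)

lemma isHomogeneousFractional_iff {A : NonzeroFractionalIdeal R K} (hA : A ≤ ring) :
    IsHomogeneousFractional 𝒜 A ↔ (integralPart A).IsHomogeneous 𝒜 := by
  constructor
  · intro h
    have h1 := integralPart_content (𝒜 := 𝒜) hA
    rw [content_eq_self hA h] at h1
    change integralPart A = _ at h1
    rw [h1]
    exact ((integralPart A).homogeneousHull 𝒜).isHomogeneous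
  · intro h
    exact ⟨1, isNonzeroHomogeneous_one 𝒜, _, h, by
      simp [coe_integralPart hA, smul, FractionalIdeal.spanSingleton_one]⟩

/-- It is enough to test homogeneous preservation on integral ideals. -/
lemma StarOperation.isHomogeneousPreserving_of_integral {star : StarOperation R K}
    (h : ∀ A : NonzeroFractionalIdeal R K, A ≤ ring → (integralPart A).IsHomogeneous 𝒜 →
      (integralPart (star.toFun A)).IsHomogeneous 𝒜) : star.IsHomogeneousPreserving 𝒜 := by
  rintro A ⟨s, hs, I, hI, e⟩
  have hle : smul (algebraMap R K s) hs.map_ne_zero A ≤ ring := by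
    change (smul (algebraMap R K s) hs.map_ne_zero A).1 ≤ 1
    rw [e]
    exact FractionalIdeal.coeIdeal_le_one
  have hint : integralPart (smul (algebraMap R K s) hs.map_ne_zero A) = I :=
    FractionalIdeal.coeIdeal_injective (K := K) ((coe_integralPart hle).trans e)
  -- The denominator s of A also serves A^⋆, because ⋆ commutes with multiplication by s.
  refine ⟨s, hs, _, h _ hle (hint ▸ hI), ?_⟩
  rw [coe_integralPart (star.map_le_ring hle), star.map_smul]

lemma exists_homogeneous_mem {I : Ideal R} (hI : I.IsHomogeneous 𝒜) (h0 : I ≠ ⊥) :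
    ∃ a ∈ I, IsNonzeroHomogeneous 𝒜 a := by
  obtain ⟨x, hx, hx0⟩ := Submodule.exists_mem_ne_zero_of_ne_bot h0
  obtain ⟨S, hS, -⟩ := sum_decompose (𝒜 := 𝒜) x
  obtain ⟨i, -, hi⟩ := Finset.exists_ne_zero_of_sum_ne_zero (hS.trans_ne hx0)
  exact ⟨_, hI i hx, hi, i, SetLike.coe_mem _⟩

lemma integralPart_ne_bot {A : NonzeroFractionalIdeal R K} (hA : A ≤ ring) :
    integralPart A ≠ ⊥ := by
  intro h
  have := coe_integralPart hA
  rw [h, FractionalIdeal.coeIdeal_bot] at this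
  exact A.2 this.symm

lemma div_mem_one_iff {a r : R} (ha : a ≠ 0) :
    algebraMap R K r / algebraMap R K a ∈ (1 : FractionalIdeal R⁰ K) ↔ r ∈ Ideal.span {a} := by
  have ha' : algebraMap R K a ≠ 0 := (map_ne_zero_iff _ (IsFractionRing.injective R K)).2 ha
  rw [FractionalIdeal.mem_one_iff, Ideal.mem_span_singleton]
  constructor
  · rintro ⟨c, hc⟩
    refine ⟨c, IsFractionRing.injective R K ?_⟩
    rw [map_mul, hc, mul_div_cancel₀ _ ha']
  · rintro ⟨c, rfl⟩
    exact ⟨c, by rw [map_mul, mul_div_cancel_left₀ _ ha']⟩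

/-- For `0 ≠ a ∈ I`, the divisorial closure of `I` is `(aR : (aR : I))`. -/
lemma integralPart_v {A : NonzeroFractionalIdeal R K} (hA : A ≤ ring) {a : R} (ha : a ≠ 0)
    (haA : a ∈ integralPart A) :
    integralPart (StarOperation.v.toFun A) =
      (Ideal.span {a}).colon ((Ideal.span {a}).colon (integralPart A : Set R) : Set R) := by
  have ha' : algebraMap R K a ≠ 0 := (map_ne_zero_iff _ (IsFractionRing.injective R K)).2 ha
  -- In terms of I = A ∩ R = A, this is A⁻¹ = a⁻¹(aR : I), on fractions with denominator a.
  have hinv : ∀ r : R, algebraMap R K r / algebraMap R K a ∈ (inv A).1 ↔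
      r ∈ (Ideal.span {a}).colon (integralPart A : Set R) := by
    intro r
    rw [mem_inv, Submodule.mem_colon]
    constructor
    · intro h s hs
      rw [smul_eq_mul, ← div_mem_one_iff (K := K) ha, map_mul, mul_div_right_comm]
      exact h _ hs
    · intro h x hx
      obtain ⟨s, rfl⟩ := (FractionalIdeal.mem_one_iff R⁰).1 (hA hx)
      rw [← mul_div_right_comm, ← map_mul, div_mem_one_iff ha]
      exact h s hx
  ext x
  rw [mem_integralPart, Submodule.mem_colon]
  refine (mem_inv (A := inv A)).trans ⟨fun h r hr => ?_, fun h b hb => ?_⟩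
  · rw [smul_eq_mul, ← div_mem_one_iff (K := K) ha, map_mul, mul_div_assoc]
    exact h _ ((hinv r).2 hr)
  -- Every b in A⁻¹ has this form: a lies in A, so r = b a lies in R.
  · obtain ⟨r, hr⟩ := (FractionalIdeal.mem_one_iff R⁰).1 
      (mem_inv.1 hb (algebraMap R K a) haA)
    obtain rfl : b = algebraMap R K r / algebraMap R K a := by rw [hr, mul_div_cancel_right₀ _ ha']
    rw [← mul_div_assoc, ← map_mul, div_mem_one_iff ha]
    exact h r ((hinv r).1 hb)

variable (K 𝒜) in
lemma isHomogeneousPreserving_v :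
    (StarOperation.v : StarOperation R K).IsHomogeneousPreserving 𝒜 := by
  refine StarOperation.isHomogeneousPreserving_of_integral fun A hA h => ?_
  obtain ⟨a, haA, ha0, hah⟩ := exists_homogeneous_mem h (integralPart_ne_bot hA)
  have haR : (Ideal.span {a}).IsHomogeneous 𝒜 :=
    Ideal.homogeneous_span 𝒜 _ (by rintro y rfl; exact hah)
  rw [integralPart_v hA ha0 haA]
  exact isHomogeneous_colon haR (isHomogeneous_colon haR h)

/-- The content of an ideal contained in a homogeneous ideal is contained in that ideal. -/
lemma content_le {A B : NonzeroFractionalIdeal R K} (hA : A ≤ ring)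
    (hB : (integralPart B).IsHomogeneous 𝒜) (hBR : B ≤ ring) (h : A ≤ B) :
    (content 𝒜 A hA).1 ≤ B := by
  have h1 := content_mono (𝒜 := 𝒜) hA hBR h
  rw [content_eq_self hBR ((isHomogeneousFractional_iff hBR).2 hB)] at h1
  exact h1

/-- If x is in B^⋆ with B ⊆ A finitely generated, then x is in C(B)^⋆, which is homogeneous and so
contains the components of x; C(B) is itself an admissible ideal for A. -/
lemma StarOperation.IsHomogeneousPreserving.finiteType {star : StarOperation R K}
    (hstar : star.IsHomogeneousPreserving 𝒜) : star.finiteType.IsHomogeneousPreserving 𝒜 := by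
  refine StarOperation.isHomogeneousPreserving_of_integral fun A hA h i x hx => ?_
  obtain ⟨B, h1, h2, h3⟩ := mem_finiteTypeClosure.1 hx
  have hB : B ≤ ring := h2.trans hA
  refine mem_finiteTypeClosure.2 ⟨(content 𝒜 B hB).1, content_fg hB h1, content_le hB h hA h2, ?_⟩
  exact (isHomogeneousFractional_iff (star.map_le_ring (content_le_ring hB))).1
    (hstar _ (content 𝒜 B hB).2) i (star.mono _ _ (le_content hB) h3)

variable (K 𝒜) in
lemma isHomogeneousPreserving_t :
    (StarOperation.t : StarOperation R K).IsHomogeneousPreserving 𝒜 :=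
  (isHomogeneousPreserving_v K 𝒜).finiteType

/-- No homogeneity of ⋆ is required: ideals J with J^⋆ = R can be enlarged to C(J), and their powers
have the same property. -/
lemma StarOperation.isHomogeneousPreserving_tilde [IsAddTorsionFree Γ]
    (star : StarOperation R K) : star.tilde.IsHomogeneousPreserving 𝒜 := by
  refine StarOperation.isHomogeneousPreserving_of_integral fun A hA h i x hx => ?_
  obtain ⟨J, ⟨hJR, hJfg, hJ⟩, hxJ⟩ := mem_tildeClosure.1 hx
  have hC : star.IsTildeIdeal (content 𝒜 J hJR).1 :=
    ⟨content_le_ring hJR, content_fg hJR hJfg,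
      le_antisymm (star.map_le_ring (content_le_ring hJR))
        (hJ.ge.trans (star.mono _ _ (le_content hJR)))⟩
  obtain ⟨m, hm⟩ := exists_homogeneousHull_pow_mul_mem h ((integralPart_fg hJR).2 hJfg)
    (x := x) fun j hj => by
      rw [mem_integralPart, map_mul]
      exact hxJ _ hj
  obtain ⟨D, hD, hDC⟩ := hC.pow m
  refine mem_tildeClosure.2 ⟨D, hD, fun d hd => ?_⟩
  have e : D.1 = ((((integralPart J).homogeneousHull 𝒜).toIdeal ^ m : Ideal R) :
      FractionalIdeal R⁰ K) := by
    rw [FractionalIdeal.coeIdeal_pow, hDC]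
    rfl
  rw [e] at hd
  obtain ⟨c, hc, rfl⟩ := (FractionalIdeal.mem_coeIdeal R⁰).1 hd
  have := hm i c hc
  rw [mem_integralPart, map_mul] at this
  exact this

variable (K 𝒜) in
lemma isHomogeneousPreserving_w [IsAddTorsionFree Γ] :
    (StarOperation.w : StarOperation R K).IsHomogeneousPreserving 𝒜 :=
  StarOperation.v.isHomogeneousPreserving_tilde

/-! ### Comparison of ⋆, e(⋆) and v -/

/-- The `v`-operation is the largest among the extensions of homogeneous star operations. -/
lemma HomogeneousStarOperation.extension_le_v (star : HomogeneousStarOperation K 𝒜) :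
    star.extension ≤ StarOperation.v := by
  intro A x hx
  refine (mem_inv (A := inv A)).2 fun z hzA => ?_
  -- The intersection defining e(⋆) runs over nonzero z only.
  by_cases hz : z = 0
  · rw [hz, mul_zero]
    exact FractionalIdeal.zero_mem _
  · rw [mul_comm]
    exact star.le_ring_of_le_ring (content_le_ring (smul_le_ring hz hzA))
      (mem_extensionFun.1 hx z hz hzA)

/-- A homogeneous preserving star operation is below the extension of its restriction. -/
lemma StarOperation.le_extension_restrict {star : StarOperation R K}
    (h : star.IsHomogeneousPreserving 𝒜) : star ≤ (star.restrict 𝒜 h).extension := by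
  intro A x hx
  refine HomogeneousStarOperation.mem_extensionFun.2 fun z hz hzA => ?_
  have h1 : z * x ∈ (star.toFun (smul z hz A)).1 := by
    rw [star.map_smul]
    exact mul_mem_smul hx
  exact star.mono _ _ (le_content (HomogeneousStarOperation.smul_le_ring hz hzA)) h1

variable (K 𝒜) in
lemma extension_restrict_v :
    (StarOperation.v.restrict 𝒜 (isHomogeneousPreserving_v K 𝒜)).extension = StarOperation.v :=
  le_antisymm (HomogeneousStarOperation.extension_le_v _)
    (StarOperation.le_extension_restrict _)

variable (K 𝒜) in
-- A squeeze: t = v_f ≤ (v_f)_f ≤ e(t)_f ≤ v_f.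
lemma finiteType_extension_restrict_t :
    (StarOperation.t.restrict 𝒜 (isHomogeneousPreserving_t K 𝒜)).extension.finiteType =
      StarOperation.t :=
  le_antisymm (StarOperation.finiteType_mono (HomogeneousStarOperation.extension_le_v _))
    ((StarOperation.le_finiteType_finiteType _).trans
      (StarOperation.finiteType_mono (StarOperation.le_extension_restrict _)))

variable (K 𝒜) in
lemma tilde_extension_restrict_w [IsAddTorsionFree Γ] :
    (StarOperation.w.restrict 𝒜 (isHomogeneousPreserving_w K 𝒜)).extension.tilde =
      StarOperation.w :=
  le_antisymm (StarOperation.tilde_mono (HomogeneousStarOperation.extension_le_v _))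
    ((StarOperation.le_tilde_tilde _).trans
      (StarOperation.tilde_mono (StarOperation.le_extension_restrict _)))

end Graded

end GradedDomain

theorem mainTheorem4 {Γ : Type*} [AddCancelCommMonoid Γ] [IsAddTorsionFree Γ]
    [Nontrivial Γ] [DecidableEq Γ]
    {R : Type*} [CommRing R] [IsDomain R] (𝒜 : Γ → AddSubgroup R) [GradedRing 𝒜]
    {K : Type*} [Field K] [Algebra R K] [IsFractionRing R K] :
    ∃ (hv : (GradedDomain.StarOperation.v : GradedDomain.StarOperation R K).IsHomogeneousPreserving 𝒜)
      (ht : (GradedDomain.StarOperation.t : GradedDomain.StarOperation R K).IsHomogeneousPreserving 𝒜)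
      (hw : (GradedDomain.StarOperation.w : GradedDomain.StarOperation R K).IsHomogeneousPreserving 𝒜),
      (GradedDomain.StarOperation.v.restrict 𝒜 hv).extension = GradedDomain.StarOperation.v ∧
      ((GradedDomain.StarOperation.v.restrict 𝒜 hv).extension.finiteType =
          (GradedDomain.StarOperation.t.restrict 𝒜 ht).extension.finiteType ∧
        (GradedDomain.StarOperation.t.restrict 𝒜 ht).extension.finiteType =
          GradedDomain.StarOperation.t) ∧
      ((GradedDomain.StarOperation.v.restrict 𝒜 hv).extension.tilde =
          (GradedDomain.StarOperation.w.restrict 𝒜 hw).extension.tilde ∧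
        (GradedDomain.StarOperation.w.restrict 𝒜 hw).extension.tilde =
          GradedDomain.StarOperation.w) := by
  have ev := GradedDomain.extension_restrict_v K 𝒜
  have et := GradedDomain.finiteType_extension_restrict_t K 𝒜
  have ew := GradedDomain.tilde_extension_restrict_w K 𝒜
  refine ⟨GradedDomain.isHomogeneousPreserving_v K 𝒜, GradedDomain.isHomogeneousPreserving_t K 𝒜,
    GradedDomain.isHomogeneousPreserving_w K 𝒜, ev, ⟨?_, et⟩, ?_, ew⟩
  -- Once e(v) = v, what is left is the definition of t as v_f, and below of w as v~.
  · rw [ev, et]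
    rfl
  · rw [ev, ew]
    rfl
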